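/- Let $\mathcal V$ be a finite-dimensional Hilbert space over $\mathbb R$ (a complex one is regarded as a real one with the scalar product $\mathrm{Re}\,\langle x,y\rangle$), let $\gamma>0$, and let $f:\mathcal V\to\mathbb R\cup\{\infty\}$. Define $\mathcal S_\gamma(f):\mathcal V\to[-\infty,\infty]$ by $$\mathcal S_\gamma(f)(y)=\sup_{x\in\mathcal V}\Big(-f(x)-\frac{\gamma}{2}\|x-y\|^2\Big).$$ A subset of a finite-dimensional real vector space is called semi-algebraic if it belongs to the smallest family of subsets that contains all sets $\{q>0\}$, $q$ a real polynomial function, and is closed under complements and finite unions. A function $g:\mathcal V\to[-\infty,\infty]$ is called semi-algebraic if its graph over the points where it is finite, $\{(x,g(x)) : g(x)\in\mathbb R\}$, is a semi-algebraic subset of $\mathcal V\times\mathbb R$ and the set $\{x : g(x)=-\infty\}$ is semi-algebraic (the second condition is void for functions with values in $\mathbb R\cup\{\infty\}$). If $f$ is semi-algebraic, then $\mathcal S_\gamma(f)$ is semi-algebraic. Moreover, if $f$ is not identically $\infty$, then $\mathcal S_\gamma(f)$ never takes the value $-\infty$, so that it again has values in $\mathbb R\cup\{\infty\}$. -/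

import Mathlib

/-- Semi-algebraic subsets of a real vector space `E`: the smallest family of subsets of `E` that
contains the sets `{x | 0 < q x}`, `q` a real polynomial function on `E`, and is closed under
complements and finite unions (hence also under finite intersections).
A polynomial function on `E` is a real polynomial in finitely many linear functionals; for `E = ℝⁿ`
these are exactly the polynomials in the `n` coordinates. -/
inductive IsSemialgebraicSet {E : Type*} [AddCommGroup E] [Module ℝ E] : Set E → Prop
  | pos {m : ℕ} (ℓ : Fin m → (E →ₗ[ℝ] ℝ)) (q : MvPolynomial (Fin m) ℝ) :
      IsSemialgebraicSet {x : E | 0 < MvPolynomial.eval (fun i => ℓ i x) q}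
  | compl {A : Set E} : IsSemialgebraicSet A → IsSemialgebraicSet Aᶜ
  | union {A B : Set E} : IsSemialgebraicSet A → IsSemialgebraicSet B →
      IsSemialgebraicSet (A ∪ B)

/-- An extended-real-valued function on `E` is semi-algebraic if its graph over the set of points
where it is finite is a semi-algebraic subset of `E × ℝ`, and the set where it equals `-∞` is
semi-algebraic. For functions with values in `ℝ ∪ {∞}` the latter set is empty, so that only the
condition on the graph remains. -/
def IsSemialgebraicFun {E : Type*} [AddCommGroup E] [Module ℝ E] (f : E → EReal) : Prop :=
  IsSemialgebraicSet {p : E × ℝ | f p.1 = (p.2 : EReal)} ∧ IsSemialgebraicSet {x : E | f x = ⊥}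

/-- The transform `S_γ(f)(y) = sup_x (-f(x) - (γ/2) ‖x - y‖²)`. -/
noncomputable def sTransform {V : Type*} [NormedAddCommGroup V] (γ : ℝ) (f : V → EReal) (y : V) :
    EReal :=
  ⨆ x : V, (-f x - ((γ / 2 * ‖x - y‖ ^ 2 : ℝ) : EReal))

/-! The strict hypograph `{(y, t) | t < S_γ f y}` is the projection of a set in `(V × ℝ) × (V × ℝ)`:
there is a point `(x, s)` on the finite graph of `f` with `-s - γ/2 ‖x - y‖² - t > 0`, a polynomial
condition. By Tarski–Seidenberg the hypograph is semi-algebraic. The finite graph of a function and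
its `-∞` set are obtained from its strict hypograph by Boolean operations and projections along `ℝ`.
If `f` is finite at one point, the term of the supremum at that point is a real lower bound.

Most of the file proves Tarski–Seidenberg for one real variable, by the Cohen–Hörmander method.
Given finitely many polynomials in `t` with coefficients in a ring `R`, close the family under
derivatives, truncation of the leading term and pseudo-remainders; each operation lowers the degree,
so a finite family suffices. If two specializations `R →+* ℝ` give all leading coefficients of this
family equal signs, the two sign diagrams on the line agree (`exists_signMatching`). The diagrams
are built by increasing degree: the sign of `p` at a zero of an earlier `q` is that of a
pseudo-remainder, up to a power of the leading coefficient (`sign_eq_at_zero`), and between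
consecutive zeros `p` is monotone because `p'` has constant sign (`exists_sign_eq`). -/

/-! ### Matching the signs of two polynomials along matched cell decompositions -/

/-- Two monotone labellings of the real line with the same set of labels, which can only change at
points of the finite sets `Z` and `W`, and for which `Z` and `W` carry the same labels. -/
structure CellMatching {L : Type*} [LinearOrder L] (c d : ℝ → L) (Z W : Set ℝ) : Prop where
  monotone_left : Monotone c
  monotone_right : Monotone d
  exists_right : ∀ t, ∃ s, c t = d s
  exists_left : ∀ s, ∃ t, c t = d s
  finite_left : Z.Finite
  finite_right : W.Finite
  mem_iff : ∀ ⦃r s⦄, c r = d s → (r ∈ Z ↔ s ∈ W)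
  separated_left : ∀ ⦃t t'⦄, t ≤ t' → c t ≠ c t' → ∃ r ∈ Z, r ∈ Set.Icc t t'
  separated_right : ∀ ⦃t t'⦄, t ≤ t' → d t ≠ d t' → ∃ r ∈ W, r ∈ Set.Icc t t'

namespace CellMatching

variable {L : Type*} [LinearOrder L] {c d : ℝ → L} {Z W : Set ℝ}

theorem symm (h : CellMatching c d Z W) : CellMatching d c W Z where
  monotone_left := h.monotone_right
  monotone_right := h.monotone_left
  exists_right s := (h.exists_left s).imp fun _ => Eq.symm
  exists_left t := (h.exists_right t).imp fun _ => Eq.symm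
  finite_left := h.finite_right
  finite_right := h.finite_left
  mem_iff _ _ hrs := (h.mem_iff hrs.symm).symm
  separated_left := h.separated_right
  separated_right := h.separated_left

theorem neg (h : CellMatching c d Z W) :
    CellMatching (fun t => OrderDual.toDual (c (-t))) (fun t => OrderDual.toDual (d (-t)))
      (-Z) (-W) where
  monotone_left _ _ hab := OrderDual.toDual_le_toDual.2 (h.monotone_left (neg_le_neg hab))
  monotone_right _ _ hab := OrderDual.toDual_le_toDual.2 (h.monotone_right (neg_le_neg hab))
  exists_right t := by
    obtain ⟨s, hs⟩ := h.exists_right (-t)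
    exact ⟨-s, by simpa using hs⟩
  exists_left s := by
    obtain ⟨t, ht⟩ := h.exists_left (-s)
    exact ⟨-t, by simpa using ht⟩
  finite_left := h.finite_left.neg
  finite_right := h.finite_right.neg
  mem_iff r s hrs := by
    have := h.mem_iff (OrderDual.toDual_inj.1 hrs)
    simpa using this
  separated_left t t' htt hne := by
    obtain ⟨r, hr, h1, h2⟩ := h.separated_left (neg_le_neg htt)
      (fun e => hne (congrArg OrderDual.toDual e.symm))
    exact ⟨-r, by simpa using hr, by linarith, by linarith⟩
  separated_right t t' htt hne := by
    obtain ⟨r, hr, h1, h2⟩ := h.separated_right (neg_le_neg htt)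
      (fun e => hne (congrArg OrderDual.toDual e.symm))
    exact ⟨-r, by simpa using hr, by linarith, by linarith⟩

/-- Otherwise monotonicity squeezes all four labels together, although a label occurs either only on
`Z` and `W` or only off them. -/
theorem lt_of_mem_of_lt (h : CellMatching c d Z W) {r r' t s : ℝ} (hts : c t = d s)
    (hrr : c r = d r') (ht : t ∉ Z) (hr : r ∈ Z) (hlt : r < t) : r' < s := by
  by_contra hle
  have h1 : d s ≤ d r' := h.monotone_right (not_lt.1 hle)
  have h2 : c r ≤ c t := h.monotone_left hlt.le
  have h3 : c r = d s := le_antisymm (hts ▸ h2) (hrr ▸ h1)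
  exact ht ((h.mem_iff hts).2 ((h.mem_iff h3).1 hr))

theorem label_eq_of_forall_notMem (h : CellMatching c d Z W) {v t : ℝ} (hv : v ≤ t)
    (hZ : ∀ r ∈ Z, v ≤ r → t < r) : c v = c t := by
  by_contra hne
  obtain ⟨r, hr, h1, h2⟩ := h.separated_left hv hne
  exact absurd (hZ r hr h1) (not_lt.2 h2)

open Polynomial

/-- A nonconstant polynomial whose derivative is positive on a left half-line takes negative
values there. -/
theorem exists_eval_neg {q : ℝ[X]} (hq : 0 < q.natDegree) {b : ℝ}
    (hpos : ∀ v ≤ b, 0 < q.derivative.eval v) : ∃ u < b, q.eval u < 0 := by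
  have hmono : StrictMonoOn (fun v => q.eval v) (Set.Iic b) := by
    refine strictMonoOn_of_deriv_pos (convex_Iic b) q.continuous.continuousOn fun v hv => ?_
    rw [interior_Iic] at hv
    rw [Polynomial.deriv]
    exact hpos v hv.le
  -- `|q|` is unbounded to the left, while `q` stays below `q b` there; where `|q|` exceeds `|q b|`,
  -- `q` must be negative.
  have hinf : Filter.Tendsto (fun v => |(q.comp (-X)).eval v|) Filter.atTop Filter.atTop := by
    refine Polynomial.abs_tendsto_atTop _ ?_
    rw [← Polynomial.natDegree_pos_iff_degree_pos, Polynomial.natDegree_comp]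
    simpa using hq
  obtain ⟨v, hv1, hv2⟩ := ((hinf.eventually_gt_atTop |q.eval b|).and
    (Filter.eventually_gt_atTop (-b))).exists
  have hvb : -v < b := by linarith
  refine ⟨-v, hvb, ?_⟩
  have hlt : q.eval (-v) < q.eval b := hmono hvb.le Set.self_mem_Iic hvb
  have hv3 : |q.eval b| < |q.eval (-v)| := by simpa using hv1
  by_contra hge
  rw [abs_of_nonneg (not_lt.1 hge), abs_of_nonneg ((not_lt.1 hge).trans hlt.le)] at hv3
  exact lt_asymm hv3 hlt

/-- On the cell of `t`, `p` increases up to a value `≤ 0`, so it is negative at the left endpoint,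
where `hsign` transfers the sign to `q`. If the cell of `s` has no left endpoint, `q' > 0` on the
whole half-line and `q` becomes negative far to the left. -/
theorem exists_neg_left (h : CellMatching c d Z W) {p q : ℝ[X]} (hq : 0 < q.natDegree)
    (hsign : ∀ ⦃r s⦄, c r = d s → r ∈ Z → SignType.sign (p.eval r) = SignType.sign (q.eval s))
    (hder : ∀ ⦃r s⦄, c r = d s →
      SignType.sign (p.derivative.eval r) = SignType.sign (q.derivative.eval s))
    {t s : ℝ} (hts : c t = d s) (ht : t ∉ Z) (hpos : 0 < p.derivative.eval t)
    (hpt : p.eval t ≤ 0) : ∃ u < s, q.eval u < 0 ∧ ∀ v, u < v → v ≤ s → d v = d s := by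
  have hs : s ∉ W := fun hs => ht ((h.mem_iff hts).2 hs)
  rcases Set.eq_empty_or_nonempty (W ∩ Set.Iio s) with hW | hW
  · have hconst : ∀ v ≤ s, d v = d s := fun v hv =>
      h.symm.label_eq_of_forall_notMem hv fun r hr _ => by
        refine lt_of_not_ge fun hle => ?_
        have : r ∈ W ∩ Set.Iio s := ⟨hr, lt_of_le_of_ne hle fun e => hs (e ▸ hr)⟩
        simp [hW] at this
    have hqpos : ∀ v ≤ s, 0 < q.derivative.eval v := fun v hv => by
      have := hder (hts.trans (hconst v hv).symm)
      rw [sign_pos hpos] at this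
      exact sign_eq_one_iff.1 this.symm
    obtain ⟨u, hu, hneg⟩ := exists_eval_neg hq hqpos
    exact ⟨u, hu, hneg, fun v _ hv => hconst v hv⟩
  · obtain ⟨b, ⟨hbW, hbs⟩, hbmax⟩ :=
      Set.exists_max_image _ id (h.finite_right.inter_of_left _) hW
    obtain ⟨b', hb'⟩ := h.exists_left b
    have hb'Z : b' ∈ Z := (h.mem_iff hb').2 hbW
    have hb't : b' < t := h.symm.lt_of_mem_of_lt hts.symm hb'.symm hs hbW hbs
    obtain ⟨a, ⟨haZ, hat⟩, hamax⟩ := Set.exists_max_image (Z ∩ Set.Iio t) id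
      (h.finite_left.inter_of_left _) ⟨b', hb'Z, hb't⟩
    obtain ⟨a', ha'⟩ := h.exists_right a
    have ha'W : a' ∈ W := (h.mem_iff ha').1 haZ
    have ha's : a' < s := h.lt_of_mem_of_lt hts ha' ht haZ hat
    -- The nearest points of `Z` and `W` to the left correspond: the partner of each competes in the
    -- maximum defining the other.
    have hab : c a = d b := le_antisymm
      (ha' ▸ h.monotone_right (hbmax a' ⟨ha'W, ha's⟩))
      (hb' ▸ h.monotone_left (hamax b' ⟨hb'Z, hb't⟩))
    have hconst : ∀ v, b < v → v ≤ s → d v = d s := fun v hbv hv =>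
      h.symm.label_eq_of_forall_notMem hv fun r hr hvr => by
        refine lt_of_not_ge fun hle => ?_
        exact absurd (hbmax r ⟨hr, lt_of_le_of_ne hle fun e => hs (e ▸ hr)⟩)
          (not_le.2 (hbv.trans_le hvr))
    have hmono : StrictMonoOn (fun v => p.eval v) (Set.Icc a t) := by
      refine strictMonoOn_of_deriv_pos (convex_Icc a t) p.continuous.continuousOn fun v hv => ?_
      rw [interior_Icc] at hv
      rw [Polynomial.deriv]
      have hcv : c v = c t := h.label_eq_of_forall_notMem hv.2.le fun r hr hvr => by
        refine lt_of_not_ge fun hle => ?_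
        exact absurd (hamax r ⟨hr, lt_of_le_of_ne hle fun e => ht (e ▸ hr)⟩)
          (not_le.2 (hv.1.trans_le hvr))
      have h1 := (hder (hcv.trans hts)).trans (hder hts).symm
      rw [sign_pos hpos] at h1
      exact sign_eq_one_iff.1 h1
    have hpa : p.eval a < 0 :=
      (hmono (Set.left_mem_Icc.2 (le_of_lt hat)) (Set.right_mem_Icc.2 (le_of_lt hat)) hat).trans_le
        hpt
    refine ⟨b, hbs, ?_, hconst⟩
    have := hsign hab haZ
    rw [sign_neg hpa] at this
    exact sign_eq_neg_one_iff.1 this.symm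

/-- Here `p t ≤ 0`, so `exists_neg_left` supplies `u` with `q u < 0` at or beyond the left end of
what is needed of the cell. A negative sign is found just right of `u`, a zero by the intermediate
value theorem. -/
theorem exists_sign_eq_of_lt (h : CellMatching c d Z W) {p q : ℝ[X]} (hq : 0 < q.natDegree)
    (hsign : ∀ ⦃r s⦄, c r = d s → r ∈ Z → SignType.sign (p.eval r) = SignType.sign (q.eval s))
    (hder : ∀ ⦃r s⦄, c r = d s →
      SignType.sign (p.derivative.eval r) = SignType.sign (q.derivative.eval s))
    {t s : ℝ} (hts : c t = d s) (ht : t ∉ Z) (hpos : 0 < p.derivative.eval t)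
    (hlt : SignType.sign (p.eval t) < SignType.sign (q.eval s)) :
    ∃ s', c t = d s' ∧ SignType.sign (p.eval t) = SignType.sign (q.eval s') := by
  have hpt : p.eval t ≤ 0 := by
    by_contra hgt
    rw [sign_pos (not_le.1 hgt)] at hlt
    revert hlt
    generalize SignType.sign (q.eval s) = σ
    revert σ
    decide
  obtain ⟨u, hus, hqu, hconst⟩ := h.exists_neg_left hq hsign hder hts ht hpos hpt
  rcases hpt.lt_or_eq with hneg | hzero
  · have hev : ∀ᶠ v in nhdsWithin u (Set.Ioi u), q.eval v < 0 :=
      (q.continuous.continuousAt.eventually_lt continuousAt_const hqu).filter_mono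
        nhdsWithin_le_nhds
    obtain ⟨v, hv, hv1, hv2⟩ := (hev.and (Ioc_mem_nhdsGT hus)).exists
    exact ⟨v, hts.trans (hconst v hv1 hv2).symm, by rw [sign_neg hneg, sign_neg hv]⟩
  · rw [hzero, sign_zero] at hlt
    have hqs : 0 < q.eval s := by
      by_contra hle
      have := SignType.sign.monotone (not_lt.1 hle)
      rw [sign_zero] at this
      exact absurd hlt (not_lt.2 this)
    obtain ⟨v, ⟨hv1, hv2⟩, hv⟩ := intermediate_value_Icc hus.le q.continuous.continuousOn
      (show (0 : ℝ) ∈ Set.Icc (q.eval u) (q.eval s) from ⟨hqu.le, hqs.le⟩)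
    have huv : u < v := lt_of_le_of_ne hv1 (by rintro rfl; exact hqu.ne hv)
    exact ⟨v, hts.trans (hconst v huv hv2).symm, by rw [hzero]; exact congrArg _ hv.symm⟩

theorem exists_sign_eq_of_pos (h : CellMatching c d Z W) {p q : ℝ[X]} (hq : 0 < q.natDegree)
    (hsign : ∀ ⦃r s⦄, c r = d s → r ∈ Z → SignType.sign (p.eval r) = SignType.sign (q.eval s))
    (hder : ∀ ⦃r s⦄, c r = d s →
      SignType.sign (p.derivative.eval r) = SignType.sign (q.derivative.eval s))
    {t : ℝ} (ht : t ∉ Z) (hpos : 0 < p.derivative.eval t) :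
    ∃ s, c t = d s ∧ SignType.sign (p.eval t) = SignType.sign (q.eval s) := by
  obtain ⟨s, hts⟩ := h.exists_right t
  rcases lt_trichotomy (SignType.sign (p.eval t)) (SignType.sign (q.eval s)) with hlt | heq | hgt
  · exact h.exists_sign_eq_of_lt hq hsign hder hts ht hpos hlt
  · exact ⟨s, hts, heq⟩
  -- The substitution `p ↦ -p(-X)` reverses the sign comparison and keeps the derivative positive.
  · obtain ⟨s', h1, h2⟩ := h.neg.exists_sign_eq_of_lt (p := -p.comp (-X)) (q := -q.comp (-X))
      (t := -t) (s := -s)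
      (by simpa [Polynomial.natDegree_comp] using hq)
      (fun r s hrs hr => by
        simpa [Left.sign_neg] using hsign (OrderDual.toDual_inj.1 hrs) (by simpa using hr))
      (fun r s hrs => by
        simpa [Polynomial.derivative_comp] using hder (OrderDual.toDual_inj.1 hrs))
      (by simpa using hts) (by simpa using ht)
      (by simpa [Polynomial.derivative_comp] using hpos)
      (by simpa [Left.sign_neg] using hgt)
    exact ⟨-s', by simpa using h1, by simpa [Left.sign_neg] using h2⟩

/-- Off `Z` the derivative of `p` is nonzero, and replacing `p, q` by `-p, -q` makes it positive. -/
theorem exists_sign_eq (h : CellMatching c d Z W) {p q : ℝ[X]} (hq : 0 < q.natDegree)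
    (hsign : ∀ ⦃r s⦄, c r = d s → r ∈ Z → SignType.sign (p.eval r) = SignType.sign (q.eval s))
    (hder : ∀ ⦃r s⦄, c r = d s →
      SignType.sign (p.derivative.eval r) = SignType.sign (q.derivative.eval s))
    (hroot : ∀ ⦃r⦄, p.derivative.eval r = 0 → r ∈ Z) (t : ℝ) :
    ∃ s, c t = d s ∧ SignType.sign (p.eval t) = SignType.sign (q.eval s) := by
  by_cases ht : t ∈ Z
  · obtain ⟨s, hs⟩ := h.exists_right t
    exact ⟨s, hs, hsign hs ht⟩
  rcases lt_trichotomy (p.derivative.eval t) 0 with hneg | hzero | hpos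
  · obtain ⟨s, h1, h2⟩ := h.exists_sign_eq_of_pos (p := -p) (q := -q) (t := t) (by simpa using hq)
      (fun r s hrs hr => by simpa [Left.sign_neg] using hsign hrs hr)
      (fun r s hrs => by simpa [Left.sign_neg] using hder hrs)
      ht (by simpa using hneg)
    exact ⟨s, h1, by simpa [Left.sign_neg] using h2⟩
  · exact absurd (hroot hzero) ht
  · exact h.exists_sign_eq_of_pos hq hsign hder ht hpos

end CellMatching

/-! ### Sign diagrams of polynomials under two specializations of the coefficients -/

section SignDiagrams

open Polynomial

/-- Pseudo-division: division with remainder after multiplication by a power of the leading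
coefficient of the divisor. -/
theorem exists_pseudoDivision {R : Type*} [CommRing R] (p q : R[X]) (hq : 0 < q.natDegree) :
    ∃ (k : ℕ) (s ρ : R[X]), C q.leadingCoeff ^ k * p = q * s + ρ ∧ ρ.natDegree < q.natDegree := by
  induction hn : p.natDegree using Nat.strong_induction_on generalizing p with
  | _ n ih =>
    subst hn
    rcases lt_or_ge p.natDegree q.natDegree with hlt | hle
    · exact ⟨0, 0, p, by simp, hlt⟩
    -- `cancelLeads` multiplies `p` by the leading coefficient of `q` and cancels the top term, at
    -- the cost of one power.
    · obtain ⟨k, s, ρ, h, hρ⟩ := ih _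
        (natDegree_cancelLeads_lt_of_natDegree_le_natDegree hle (hq.trans_le hle))
        (q.cancelLeads p) rfl
      refine ⟨k + 1, s + C q.leadingCoeff ^ k * (C p.leadingCoeff *
        X ^ (p.natDegree - q.natDegree)), ρ, ?_, hρ⟩
      rw [cancelLeads, Nat.sub_eq_zero_of_le hle] at h
      linear_combination h

/-- A finite set is contained in a finite set closed under an operation that lowers the degree
of its second argument, applied to pairs whose first argument has the larger degree. -/
theorem exists_finset_closed {α : Type*} (deg : α → ℕ) (op : α → α → Finset α)
    (hop : ∀ p q r, 0 < deg q → r ∈ op p q → deg r < deg q) (F : Finset α) :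
    ∃ F', F ⊆ F' ∧ ∀ p ∈ F', ∀ q ∈ F', 0 < deg q → deg q ≤ deg p → op p q ⊆ F' := by
  classical
  obtain ⟨N, hN⟩ : ∃ N, ∀ p ∈ F, deg p < N :=
    ⟨F.sup deg + 1, fun p hp => Nat.lt_succ_of_le (Finset.le_sup hp)⟩
  have key : ∀ k, ∃ F', F ⊆ F' ∧ (∀ p ∈ F', deg p < N) ∧ ∀ p ∈ F', ∀ q ∈ F', N ≤ deg q + k →
      0 < deg q → deg q ≤ deg p → op p q ⊆ F' := by
    intro k
    induction k with
    | zero => exact ⟨F, subset_rfl, hN, fun p _ q hq h => absurd (hN q hq) (not_lt.2 h)⟩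
    | succ k ih =>
      obtain ⟨F', hF, hlt, hcl⟩ := ih
      -- Closure proceeds by decreasing degree of the second argument. The results for degree `N - k
      -- - 1` have smaller degree, so they create no new pairs at the levels already treated.
      let F₁ := ((F' ×ˢ F').filter fun a => N = deg a.2 + k + 1 ∧ 0 < deg a.2).biUnion
        fun a => op a.1 a.2
      have hF₁ : ∀ r ∈ F₁, deg r + k + 1 < N := by
        intro r hr
        obtain ⟨⟨p, q⟩, ha, hr⟩ := Finset.mem_biUnion.1 hr
        obtain ⟨-, h1, h2⟩ := Finset.mem_filter.1 ha
        have := hop p q r h2 hr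
        dsimp only at h1
        omega
      have hmem : ∀ r ∈ F' ∪ F₁, N ≤ deg r + (k + 1) → r ∈ F' := fun r hr h =>
        (Finset.mem_union.1 hr).resolve_right fun h' => by
          have := hF₁ r h'
          omega
      refine ⟨F' ∪ F₁, hF.trans Finset.subset_union_left, ?_, ?_⟩
      · intro r hr
        rcases Finset.mem_union.1 hr with h | h
        · exact hlt r h
        · have := hF₁ r h
          omega
      · intro p hp q hq h h0 hle
        have hp' := hmem p hp (by omega)
        have hq' := hmem q hq h
        rcases Nat.lt_or_ge (deg q + k) N with h1 | h1
        · refine fun r hr => Finset.mem_union_right _ (Finset.mem_biUnion.2 ⟨(p, q), ?_, hr⟩)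
          simp only [Finset.mem_filter, Finset.mem_product]
          exact ⟨⟨hp', hq'⟩, by omega, h0⟩
        · exact (hcl p hp' q hq' h1 h0 hle).trans Finset.subset_union_left
  obtain ⟨F', hF, -, hcl⟩ := key N
  exact ⟨F', hF, fun p hp q hq => hcl p hp q hq (by omega)⟩

variable {R : Type*} [CommRing R]

/-- The real zeros of the members of `S` that stay nonzero under the specialization `x`. -/
def specializedZeros (x : R →+* ℝ) (S : Set R[X]) : Set ℝ :=
  {r | ∃ p ∈ S, p.map x ≠ 0 ∧ (p.map x).eval r = 0}

theorem finite_specializedZeros (x : R →+* ℝ) {S : Set R[X]} (hS : S.Finite) :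
    (specializedZeros x S).Finite := by
  refine (hS.biUnion (t := fun p => {r | p.map x ≠ 0 ∧ (p.map x).eval r = 0})
    fun p _ => ?_).subset ?_
  · by_cases hp : p.map x = 0
    · simp [hp]
    · exact ((p.map x).roots.toFinset.finite_toSet).subset fun r hr => by
        simpa [hp, Polynomial.IsRoot] using hr.2
  · rintro r ⟨p, hp, h⟩
    exact Set.mem_biUnion hp h

theorem specializedZeros_mono (x : R →+* ℝ) {S T : Set R[X]} (hST : S ⊆ T) :
    specializedZeros x S ⊆ specializedZeros x T :=
  fun _ ⟨p, hp, h⟩ => ⟨p, hST hp, h⟩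

/-- Labellings of the real line that match the sign diagrams of the members of `S` under the two
specializations `x` and `y`. -/
structure SignMatching {L : Type*} [LinearOrder L] (x y : R →+* ℝ) (S : Set R[X])
    (c d : ℝ → L) : Prop where
  cells : CellMatching c d (specializedZeros x S) (specializedZeros y S)
  sign_eq : ∀ ⦃t s⦄, c t = d s → ∀ p ∈ S,
    SignType.sign ((p.map x).eval t) = SignType.sign ((p.map y).eval s)

theorem eval_eq_zero_iff_of_sign_eq {p q : ℝ[X]} {t s : ℝ}
    (h : SignType.sign (p.eval t) = SignType.sign (q.eval s)) : p.eval t = 0 ↔ q.eval s = 0 := by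
  rw [← sign_eq_zero_iff, h, sign_eq_zero_iff]

/-- A polynomial vanishing identically under `y` would, by the matched signs, vanish everywhere
under `x`; so nonvanishing transfers too. -/
theorem mem_specializedZeros_of_sign_eq {L : Type*} {x y : R →+* ℝ} {S : Set R[X]}
    {c d : ℝ → L} (hcd : ∀ t, ∃ s, c t = d s)
    (hsign : ∀ ⦃t s⦄, c t = d s → ∀ p ∈ S,
      SignType.sign ((p.map x).eval t) = SignType.sign ((p.map y).eval s))
    {r s : ℝ} (hrs : c r = d s) (hr : r ∈ specializedZeros x S) : s ∈ specializedZeros y S := by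
  obtain ⟨p, hp, hne, h0⟩ := hr
  refine ⟨p, hp, fun hy => hne ?_, (eval_eq_zero_iff_of_sign_eq (hsign hrs p hp)).1 h0⟩
  refine Polynomial.funext fun t => ?_
  obtain ⟨s', hs'⟩ := hcd t
  rw [eval_zero, eval_eq_zero_iff_of_sign_eq (hsign hs' p hp), hy, eval_zero]

namespace SignMatching

theorem symm {L : Type*} [LinearOrder L] {x y : R →+* ℝ} {S : Set R[X]} {c d : ℝ → L}
    (h : SignMatching x y S c d) : SignMatching y x S d c :=
  ⟨h.cells.symm, fun _ _ hts p hp => (h.sign_eq hts.symm p hp).symm⟩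

/-- Labellings for which equal labels imply equal signs form a sign matching. -/
theorem of_sign_eq {L : Type*} [LinearOrder L] {x y : R →+* ℝ} {S : Set R[X]} (hS : S.Finite)
    {c d : ℝ → L} (hc : Monotone c) (hd : Monotone d) (hcd : ∀ t, ∃ s, c t = d s)
    (hdc : ∀ s, ∃ t, c t = d s)
    (hsign : ∀ ⦃t s⦄, c t = d s → ∀ p ∈ S,
      SignType.sign ((p.map x).eval t) = SignType.sign ((p.map y).eval s))
    (hsepc : ∀ ⦃t t'⦄, t ≤ t' → c t ≠ c t' → ∃ r ∈ specializedZeros x S, r ∈ Set.Icc t t')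
    (hsepd : ∀ ⦃t t'⦄, t ≤ t' → d t ≠ d t' → ∃ r ∈ specializedZeros y S, r ∈ Set.Icc t t') :
    SignMatching x y S c d where
  cells := {
    monotone_left := hc
    monotone_right := hd
    exists_right := hcd
    exists_left := hdc
    finite_left := finite_specializedZeros x hS
    finite_right := finite_specializedZeros y hS
    mem_iff := fun _ _ hrs => ⟨mem_specializedZeros_of_sign_eq hcd hsign hrs,
      mem_specializedZeros_of_sign_eq (fun s => (hdc s).imp fun _ => Eq.symm)
        (fun _ _ hts p hp => (hsign hts.symm p hp).symm) hrs.symm⟩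
    separated_left := hsepc
    separated_right := hsepd }
  sign_eq := hsign

variable {L : Type*} [LinearOrder L] {x y : R →+* ℝ} {S : Set R[X]} {c d : ℝ → L}

theorem insert_of_sign_eq (h : SignMatching x y S c d) (hS : S.Finite) {p : R[X]}
    (hp : ∀ ⦃t s⦄, c t = d s →
      SignType.sign ((p.map x).eval t) = SignType.sign ((p.map y).eval s)) :
    SignMatching x y (insert p S) c d := by
  refine of_sign_eq (hS.insert p) h.cells.monotone_left h.cells.monotone_right
    h.cells.exists_right h.cells.exists_left ?_ ?_ ?_
  · rintro t s hts q (rfl | hq)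
    · exact hp hts
    · exact h.sign_eq hts q hq
  · intro t t' htt hne
    obtain ⟨r, hr, hr'⟩ := h.cells.separated_left htt hne
    exact ⟨r, specializedZeros_mono x (Set.subset_insert p S) hr, hr'⟩
  · intro t t' htt hne
    obtain ⟨r, hr, hr'⟩ := h.cells.separated_right htt hne
    exact ⟨r, specializedZeros_mono y (Set.subset_insert p S) hr, hr'⟩

/-- Refinement of a labelling by the sign of `p`, oriented by the sign of its derivative. -/
noncomputable def refine (c : ℝ → L) (p : ℝ[X]) (t : ℝ) : L ×ₗ SignType :=
  toLex (c t, SignType.sign (p.derivative.eval t) * SignType.sign (p.eval t))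

theorem sign_eq_of_label_eq (h : SignMatching x y S c d) {p : R[X]} (hp : p ∈ S) {t t' : ℝ}
    (htt : c t = c t') :
    SignType.sign ((p.map x).eval t) = SignType.sign ((p.map x).eval t') := by
  obtain ⟨s, hs⟩ := h.cells.exists_right t'
  rw [h.sign_eq (htt.trans hs) p hp, h.sign_eq hs p hp]

/-- Within a cell of `c` the derivative has constant sign, so multiplying by that sign turns `p`
into a nondecreasing function. -/
theorem refine_monotone (h : SignMatching x y S c d) {p : R[X]} (hp : derivative p ∈ S) :
    Monotone (refine c (p.map x)) := by
  intro t t' htt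
  rw [refine, refine, Prod.Lex.toLex_le_toLex]
  refine (h.cells.monotone_left htt).lt_or_eq.imp id fun (heq : c t = c t') => ⟨heq, ?_⟩
  have hsign : ∀ u ∈ Set.Icc t t', SignType.sign ((p.map x).derivative.eval u) =
      SignType.sign ((p.map x).derivative.eval t) := by
    intro u hu
    rw [derivative_map]
    exact h.sign_eq_of_label_eq hp (le_antisymm ((h.cells.monotone_left hu.2).trans heq.ge)
      (h.cells.monotone_left hu.1))
  dsimp only
  rw [hsign t' ⟨htt, le_rfl⟩]
  have hcont := (p.map x).continuous.continuousOn (s := Set.Icc t t')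
  have hdiff := (p.map x).differentiable.differentiableOn (s := interior (Set.Icc t t'))
  rcases lt_trichotomy ((p.map x).derivative.eval t) 0 with h0 | h0 | h0
  · have : (p.map x).eval t' ≤ (p.map x).eval t := by
      refine antitoneOn_of_deriv_nonpos (convex_Icc t t') hcont hdiff (fun u hu => ?_)
        ⟨le_rfl, htt⟩ ⟨htt, le_rfl⟩ htt
      have h1 := hsign u (interior_subset hu)
      rw [sign_neg h0, sign_eq_neg_one_iff] at h1
      rw [Polynomial.deriv]
      exact h1.le
    rw [sign_neg h0]
    have h2 := SignType.sign.monotone this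
    revert h2
    generalize SignType.sign ((p.map x).eval t) = a
    generalize SignType.sign ((p.map x).eval t') = b
    revert a b
    decide
  · rw [h0, sign_zero, zero_mul, zero_mul]
  · have : (p.map x).eval t ≤ (p.map x).eval t' := by
      refine monotoneOn_of_deriv_nonneg (convex_Icc t t') hcont hdiff (fun u hu => ?_)
        ⟨le_rfl, htt⟩ ⟨htt, le_rfl⟩ htt
      have h1 := hsign u (interior_subset hu)
      rw [sign_pos h0, sign_eq_one_iff] at h1
      rw [Polynomial.deriv]
      exact h1.le
    rw [sign_pos h0, one_mul, one_mul]
    exact SignType.sign.monotone this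

theorem refine_separated (h : SignMatching x y S c d) {p : R[X]} (hp : derivative p ∈ S)
    (hne : p.map x ≠ 0) {t t' : ℝ} (htt : t ≤ t')
    (hcc : refine c (p.map x) t ≠ refine c (p.map x) t') :
    ∃ r ∈ specializedZeros x (insert p S), r ∈ Set.Icc t t' := by
  by_cases heq : c t = c t'
  · by_contra hno
    push Not at hno
    have hroot : ∀ r ∈ Set.Icc t t', (p.map x).eval r ≠ 0 := fun r hr h0 =>
      hno r ⟨p, Set.mem_insert _ _, hne, h0⟩ hr
    have hder := h.sign_eq_of_label_eq hp heq
    rw [← derivative_map] at hder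
    refine hcc ?_
    rw [refine, refine, heq, hder]
    suffices hs : SignType.sign ((p.map x).eval t) = SignType.sign ((p.map x).eval t') by rw [hs]
    have hcont := (p.map x).continuous.continuousOn (s := Set.Icc t t')
    rcases (hroot t ⟨le_rfl, htt⟩).lt_or_gt with h1 | h1 <;>
      rcases (hroot t' ⟨htt, le_rfl⟩).lt_or_gt with h2 | h2
    · rw [sign_neg h1, sign_neg h2]
    · obtain ⟨r, hr, hr0⟩ := intermediate_value_Icc htt hcont
        (show (0 : ℝ) ∈ Set.Icc _ _ from ⟨h1.le, h2.le⟩)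
      exact absurd hr0 (hroot r hr)
    · obtain ⟨r, hr, hr0⟩ := intermediate_value_Icc' htt hcont
        (show (0 : ℝ) ∈ Set.Icc _ _ from ⟨h2.le, h1.le⟩)
      exact absurd hr0 (hroot r hr)
    · rw [sign_pos h1, sign_pos h2]
  · obtain ⟨r, hr, hr'⟩ := h.cells.separated_left htt heq
    exact ⟨r, specializedZeros_mono x (Set.subset_insert p S) hr, hr'⟩

theorem exists_refine_eq (h : SignMatching x y S c d) {p : R[X]} (hp : derivative p ∈ S)
    (hdx : (derivative p).map x ≠ 0) (hy : 0 < (p.map y).natDegree)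
    (hsign : ∀ ⦃r s⦄, c r = d s → r ∈ specializedZeros x S →
      SignType.sign ((p.map x).eval r) = SignType.sign ((p.map y).eval s)) (t : ℝ) :
    ∃ s, refine c (p.map x) t = refine d (p.map y) s := by
  have hder : ∀ ⦃r s⦄, c r = d s → SignType.sign ((p.map x).derivative.eval r) =
      SignType.sign ((p.map y).derivative.eval s) := fun r s hrs => by
    rw [derivative_map, derivative_map]
    exact h.sign_eq hrs _ hp
  obtain ⟨s, h1, h2⟩ := h.cells.exists_sign_eq hy hsign hder
    (fun r hr => ⟨_, hp, hdx, by rwa [← derivative_map]⟩) t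
  exact ⟨s, by rw [refine, refine, h1, h2, hder h1]⟩

theorem insert_refine (h : SignMatching x y S c d) (hS : S.Finite) {p : R[X]}
    (hp : derivative p ∈ S) (hx : 0 < (p.map x).natDegree) (hy : 0 < (p.map y).natDegree)
    (hsign : ∀ ⦃r s⦄, c r = d s → r ∈ specializedZeros x S →
      SignType.sign ((p.map x).eval r) = SignType.sign ((p.map y).eval s)) :
    SignMatching x y (insert p S) (refine c (p.map x)) (refine d (p.map y)) := by
  have hdx : (derivative p).map x ≠ 0 := by
    rw [← derivative_map]
    exact fun h0 => hx.ne' (derivative_eq_zero.1 h0)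
  have hdy : (derivative p).map y ≠ 0 := by
    rw [← derivative_map]
    exact fun h0 => hy.ne' (derivative_eq_zero.1 h0)
  refine of_sign_eq (hS.insert p) (h.refine_monotone hp) (h.symm.refine_monotone hp)
    (h.exists_refine_eq hp hdx hy hsign) (fun s => ?_) ?_
    (fun t t' => h.refine_separated hp (fun h0 => by simp [h0] at hx))
    (fun t t' => h.symm.refine_separated hp (fun h0 => by simp [h0] at hy))
  · obtain ⟨t, ht⟩ := h.symm.exists_refine_eq hp hdy hx
      (fun r s hrs hr => (hsign hrs.symm ((h.cells.mem_iff hrs.symm).2 hr)).symm) s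
    exact ⟨t, ht.symm⟩
  · intro t s hts q hq
    obtain ⟨h1, h2⟩ := Prod.ext_iff.1 (toLex.injective hts)
    dsimp only at h1 h2
    rcases hq with rfl | hq
    · have hder := h.sign_eq h1 _ hp
      rw [← derivative_map, ← derivative_map] at hder
      -- At a zero of the derivative the refined label forgets the sign of `q`, but such a point is
      -- a specialized zero, covered by `hsign`. Elsewhere the nonzero factor cancels.
      by_cases h0 : (q.map x).derivative.eval t = 0
      · exact hsign h1 ⟨_, hp, hdx, by rwa [← derivative_map]⟩
      · rw [← hder] at h2
        have h0' : SignType.sign ((q.map x).derivative.eval t) ≠ 0 := by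
          rwa [Ne, sign_eq_zero_iff]
        revert h2 h0'
        generalize SignType.sign ((q.map x).derivative.eval t) = a
        generalize SignType.sign ((q.map x).eval t) = b
        generalize SignType.sign ((q.map y).eval s) = e
        revert a b e
        decide
    · exact h.sign_eq h1 q hq

end SignMatching

theorem map_eq_map_eraseLead {x : R →+* ℝ} {p : R[X]} (h : x p.leadingCoeff = 0) :
    p.map x = p.eraseLead.map x := by
  conv_lhs => rw [← p.eraseLead_add_C_mul_X_pow]
  rw [Polynomial.map_add, Polynomial.map_mul, map_C, h, C_0, zero_mul, add_zero]

theorem natDegree_eraseLead_lt {p : R[X]} (hp : 0 < p.natDegree) :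
    p.eraseLead.natDegree < p.natDegree :=
  lt_of_le_of_lt p.eraseLead_natDegree_le (by omega)

/-- The sign of `p` at a zero of a member `q` of `S` is matched, provided that `S` contains
the truncations of `q` and the pseudo-remainders of `p` modulo them. -/
theorem SignMatching.sign_eq_at_zero {L : Type*} [LinearOrder L] {x y : R →+* ℝ} {S : Set R[X]}
    {c d : ℝ → L} (h : SignMatching x y S c d) {p : R[X]} {rem : R[X] → R[X] → R[X]}
    (hrem : ∀ q : R[X], 0 < q.natDegree → ∃ (k : ℕ) (s : R[X]),
      C q.leadingCoeff ^ k * p = q * s + rem p q)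
    (hlead : ∀ q ∈ S, SignType.sign (x q.leadingCoeff) = SignType.sign (y q.leadingCoeff))
    (herase : ∀ q ∈ S, 0 < q.natDegree → q.eraseLead ∈ S)
    (hremS : ∀ q ∈ S, 0 < q.natDegree → rem p q ∈ S)
    {r s : ℝ} (hrs : c r = d s) {q : R[X]} (hq : q ∈ S) (hne : q.map x ≠ 0)
    (hr : (q.map x).eval r = 0) :
    SignType.sign ((p.map x).eval r) = SignType.sign ((p.map y).eval s) := by
  induction hn : q.natDegree using Nat.strong_induction_on generalizing q with
  | _ n ih =>
    subst hn
    rcases Nat.eq_zero_or_pos q.natDegree with h0 | hpos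
    · rw [eq_C_of_natDegree_eq_zero h0, map_C, eval_C] at hr
      rw [eq_C_of_natDegree_eq_zero h0, map_C, hr, C_0] at hne
      exact absurd rfl hne
    by_cases hlc : x q.leadingCoeff = 0
    · rw [map_eq_map_eraseLead hlc] at hne hr
      exact ih _ (natDegree_eraseLead_lt hpos) (herase q hq hpos) hne hr rfl
    · obtain ⟨k, u, hk⟩ := hrem q hpos
      have hs : (q.map y).eval s = 0 := (eval_eq_zero_iff_of_sign_eq (h.sign_eq hrs q hq)).1 hr
      have hx : x q.leadingCoeff ^ k * (p.map x).eval r = ((rem p q).map x).eval r := by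
        have := congrArg (fun f => (f.map x).eval r) hk
        simpa [hr] using this
      have hy : y q.leadingCoeff ^ k * (p.map y).eval s = ((rem p q).map y).eval s := by
        have := congrArg (fun f => (f.map y).eval s) hk
        simpa [hs] using this
      have h1 := h.sign_eq hrs _ (hremS q hq hpos)
      have h2 : SignType.sign (x q.leadingCoeff ^ k) ≠ 0 := by
        rw [Ne, sign_eq_zero_iff]
        exact pow_ne_zero k hlc
      rw [← hx, ← hy, sign_mul, sign_mul, sign_pow (y _), ← hlead q hq, ← sign_pow] at h1
      revert h1 h2
      generalize SignType.sign (x q.leadingCoeff ^ k) = a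
      generalize SignType.sign ((p.map x).eval r) = b
      generalize SignType.sign ((p.map y).eval s) = e
      revert a b e
      decide

theorem natDegree_map_pos {x : R →+* ℝ} {p : R[X]} (hp : 0 < p.natDegree)
    (hx : x p.leadingCoeff ≠ 0) : 0 < (p.map x).natDegree := by
  rwa [natDegree_map_of_leadingCoeff_ne_zero x hx]

/-- Induction on the size of `S`, removing a member `p` of maximal degree; `hlow` puts its
derivative, truncation and remainders among the rest. If the leading coefficient specializes to
zero, `p` agrees with its truncation; otherwise the cells are refined by `p`. -/
theorem exists_signMatching {x y : R →+* ℝ} {F : Finset R[X]} {rem : R[X] → R[X] → R[X]}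
    (hrem : ∀ p q : R[X], 0 < q.natDegree → ∃ (k : ℕ) (s : R[X]),
      C q.leadingCoeff ^ k * p = q * s + rem p q)
    (hremdeg : ∀ p q : R[X], 0 < q.natDegree → (rem p q).natDegree < q.natDegree)
    (hremF : ∀ p ∈ F, ∀ q ∈ F, 0 < q.natDegree → q.natDegree ≤ p.natDegree → rem p q ∈ F)
    (hder : ∀ p ∈ F, 0 < p.natDegree → derivative p ∈ F)
    (herase : ∀ p ∈ F, 0 < p.natDegree → p.eraseLead ∈ F)
    (hlead : ∀ q ∈ F, SignType.sign (x q.leadingCoeff) = SignType.sign (y q.leadingCoeff))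
    (S : Finset R[X]) (hSF : S ⊆ F)
    (hlow : ∀ p ∈ S, ∀ q ∈ F, q.natDegree < p.natDegree → q ∈ S) :
    ∃ (L : Type) (_ : LinearOrder L) (c d : ℝ → L), SignMatching x y (S : Set R[X]) c d := by
  classical
  induction hn : S.card generalizing S with
  | zero =>
    obtain rfl := Finset.card_eq_zero.1 hn
    refine ⟨Unit, inferInstance, fun _ => (), fun _ => (), SignMatching.of_sign_eq
      (Finset.finite_toSet _) monotone_const monotone_const (fun t => ⟨t, rfl⟩)
      (fun t => ⟨t, rfl⟩) ?_ ?_ ?_⟩ <;> simp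
  | succ n ih =>
    obtain ⟨p, hpS, hmax⟩ := S.exists_max_image natDegree (Finset.card_pos.1 (by omega))
    have hp := hSF hpS
    have hmem : ∀ q ∈ F, q.natDegree < p.natDegree → q ∈ (S.erase p : Finset R[X]) :=
      fun q hq hlt => Finset.mem_erase.2 ⟨by rintro rfl; exact lt_irrefl _ hlt,
        hlow p hpS q hq hlt⟩
    obtain ⟨L, hL, c, d, h⟩ := ih (S.erase p) ((Finset.erase_subset p S).trans hSF)
      (fun a ha q hq hlt => hmem q hq (hlt.trans_le (hmax a (Finset.mem_of_mem_erase ha))))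
      (by rw [Finset.card_erase_of_mem hpS]; omega)
    have hS : (S : Set R[X]) = insert p ((S.erase p : Finset R[X]) : Set R[X]) := by
      rw [← Finset.coe_insert, Finset.insert_erase hpS]
    have hfin := Finset.finite_toSet (S.erase p)
    rw [hS]
    rcases Nat.eq_zero_or_pos p.natDegree with h0 | hpos
    · refine ⟨L, hL, c, d, h.insert_of_sign_eq hfin fun t s _ => ?_⟩
      have := hlead p hp
      rw [leadingCoeff, h0] at this
      rw [eq_C_of_natDegree_eq_zero h0]
      simpa using this
    · have hesub : ∀ q ∈ S.erase p, q ∈ F := fun q hq => hSF (Finset.mem_of_mem_erase hq)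
      have hedeg : ∀ q ∈ S.erase p, q.natDegree ≤ p.natDegree :=
        fun q hq => hmax q (Finset.mem_of_mem_erase hq)
      by_cases hx : x p.leadingCoeff = 0
      · have hy : y p.leadingCoeff = 0 := by
          rw [← sign_eq_zero_iff, ← hlead p hp, hx, sign_zero]
        refine ⟨L, hL, c, d, h.insert_of_sign_eq hfin fun t s hts => ?_⟩
        rw [map_eq_map_eraseLead hx, map_eq_map_eraseLead hy]
        exact h.sign_eq hts _ (hmem _ (herase p hp hpos) (natDegree_eraseLead_lt hpos))
      · have hy : y p.leadingCoeff ≠ 0 := by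
          rwa [Ne, ← sign_eq_zero_iff, ← hlead p hp, sign_eq_zero_iff]
        refine ⟨L ×ₗ SignType, inferInstance, _, _, h.insert_refine hfin
          (hmem _ (hder p hp hpos) (natDegree_derivative_lt hpos.ne'))
          (natDegree_map_pos hpos hx) (natDegree_map_pos hpos hy) ?_⟩
        rintro r s hrs ⟨q, hq, hne, hr⟩
        refine h.sign_eq_at_zero (hrem p) (fun q hq => hlead q (hesub q hq))
          (fun q hq hqpos => hmem _ (herase q (hesub q hq) hqpos)
            ((natDegree_eraseLead_lt hqpos).trans_le (hedeg q hq)))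
          (fun q hq hqpos => hmem _ (hremF p hp q (hesub q hq) hqpos (hedeg q hq))
            ((hremdeg p q hqpos).trans_le (hedeg q hq))) hrs hq hne hr

/-- Elimination of one real variable: the set of sign vectors realized by finitely many
polynomials depends only on the signs of finitely many elements of the coefficient ring. -/
theorem exists_finset_sign_determining (F : Finset R[X]) :
    ∃ G : Finset R, ∀ x y : R →+* ℝ,
      (∀ g ∈ G, SignType.sign (x g) = SignType.sign (y g)) →
      ∀ t, ∃ s, ∀ p ∈ F,
        SignType.sign ((p.map x).eval t) = SignType.sign ((p.map y).eval s) := by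
  classical
  have hdiv : ∀ p q : R[X], ∃ ρ : R[X], 0 < q.natDegree →
      (∃ (k : ℕ) (s : R[X]), C q.leadingCoeff ^ k * p = q * s + ρ) ∧
        ρ.natDegree < q.natDegree := by
    intro p q
    by_cases hq : 0 < q.natDegree
    · obtain ⟨k, s, ρ, h1, h2⟩ := exists_pseudoDivision p q hq
      exact ⟨ρ, fun _ => ⟨⟨k, s, h1⟩, h2⟩⟩
    · exact ⟨0, fun h => absurd h hq⟩
  choose rem hrem using hdiv
  obtain ⟨F', hF, hcl⟩ := exists_finset_closed natDegree
    (fun p q : R[X] => {rem p q, derivative q, q.eraseLead}) (by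
      intro p q r hq hr
      simp only [Finset.mem_insert, Finset.mem_singleton] at hr
      rcases hr with rfl | rfl | rfl
      · exact (hrem p q hq).2
      · exact natDegree_derivative_lt hq.ne'
      · exact natDegree_eraseLead_lt hq) F
  refine ⟨F'.image leadingCoeff, fun x y hxy t => ?_⟩
  obtain ⟨L, hL, c, d, h⟩ := exists_signMatching (x := x) (y := y) (F := F') (rem := rem)
    (fun p q hq => (hrem p q hq).1) (fun p q hq => (hrem p q hq).2)
    (fun p hp q hq h0 hle => hcl p hp q hq h0 hle (by simp))
    (fun p hp h0 => hcl p hp p hp h0 le_rfl (by simp))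
    (fun p hp h0 => hcl p hp p hp h0 le_rfl (by simp))
    (fun q hq => hxy _ (Finset.mem_image_of_mem _ hq)) F' subset_rfl (fun _ _ q hq _ => hq)
  obtain ⟨s, hs⟩ := h.cells.exists_right t
  exact ⟨s, fun p hp => h.sign_eq hs p (hF hp)⟩

end SignDiagrams

/-! ### Semi-algebraic sets and the Tarski–Seidenberg theorem -/

section Semialgebraic

variable {E : Type*} [AddCommGroup E] [Module ℝ E]

/-- Evaluation at `x` of polynomials in the linear functionals on `E`. -/
noncomputable def functionalEval (x : E) : MvPolynomial (E →ₗ[ℝ] ℝ) ℝ →+* ℝ :=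
  MvPolynomial.eval fun ℓ => ℓ x

namespace IsSemialgebraicSet

theorem inter {A B : Set E} (hA : IsSemialgebraicSet A) (hB : IsSemialgebraicSet B) :
    IsSemialgebraicSet (A ∩ B) := by
  have := (hA.compl.union hB.compl).compl
  rwa [Set.compl_union, compl_compl, compl_compl] at this

theorem empty : IsSemialgebraicSet (∅ : Set E) := by
  simpa using IsSemialgebraicSet.pos (E := E) (m := 0) (fun _ => 0) 0

theorem iUnion {ι : Type*} [Finite ι] {A : ι → Set E} (hA : ∀ i, IsSemialgebraicSet (A i)) :
    IsSemialgebraicSet (⋃ i, A i) := by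
  have key : ∀ T : Set ι, IsSemialgebraicSet (⋃ i ∈ T, A i) := fun T => by
    induction T, T.toFinite using Set.Finite.induction_on with
    | empty => simpa using empty
    | insert _ _ ih =>
      rw [Set.biUnion_insert]
      exact (hA _).union ih
  simpa using key Set.univ

theorem iInter {ι : Type*} [Finite ι] {A : ι → Set E} (hA : ∀ i, IsSemialgebraicSet (A i)) :
    IsSemialgebraicSet (⋂ i, A i) := by
  have := (iUnion fun i => (hA i).compl).compl
  rwa [Set.compl_iUnion, Set.iInter_congr fun i => compl_compl (A i)] at this

theorem preimage {E' : Type*} [AddCommGroup E'] [Module ℝ E'] {A : Set E'}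
    (hA : IsSemialgebraicSet A) (g : E →ₗ[ℝ] E') : IsSemialgebraicSet (g ⁻¹' A) := by
  induction hA with
  | pos ℓ q => exact IsSemialgebraicSet.pos (fun i => ℓ i ∘ₗ g) q
  | compl _ ih => exact ih.compl
  | union _ _ ihA ihB => exact ihA.union ihB

theorem functionalEval_pos (q : MvPolynomial (E →ₗ[ℝ] ℝ) ℝ) :
    IsSemialgebraicSet {x : E | 0 < functionalEval x q} := by
  obtain ⟨n, ℓ, -, q, rfl⟩ := q.exists_fin_rename
  simpa [functionalEval, MvPolynomial.eval_rename, Function.comp_def] using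
    IsSemialgebraicSet.pos ℓ q

theorem sign_functionalEval_eq (q : MvPolynomial (E →ₗ[ℝ] ℝ) ℝ) (σ : SignType) :
    IsSemialgebraicSet {x : E | SignType.sign (functionalEval x q) = σ} := by
  have hpos := functionalEval_pos q
  have hneg := functionalEval_pos (-q)
  simp only [map_neg, Left.neg_pos_iff] at hneg
  cases σ with
  | pos => exact (Set.ext fun x => sign_eq_one_iff (a := functionalEval x q)) ▸ hpos
  | neg => exact (Set.ext fun x => sign_eq_neg_one_iff (a := functionalEval x q)) ▸ hneg
  | zero =>
    convert (hpos.union hneg).compl using 1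
    ext x
    simp only [Set.mem_ofPred_eq, Set.mem_compl_iff, Set.mem_union, not_or, not_lt]
    exact (sign_eq_zero_iff (a := functionalEval x q)).trans le_antisymm_iff

/-- A set is semi-algebraic if membership only depends on the signs of finitely many
polynomials. -/
theorem of_sign_determined {A : Set E} (G : Finset (MvPolynomial (E →ₗ[ℝ] ℝ) ℝ))
    (hG : ∀ x y : E, (∀ g ∈ G, SignType.sign (functionalEval x g) =
      SignType.sign (functionalEval y g)) → x ∈ A → y ∈ A) : IsSemialgebraicSet A := by
  have hA : A = ⋃ σ : {σ : G → SignType // ∃ x ∈ A, ∀ g : G,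
      SignType.sign (functionalEval x g.1) = σ g},
      ⋂ g : G, {y | SignType.sign (functionalEval y g.1) = σ.1 g} := by
    ext y
    simp only [Set.mem_iUnion, Set.mem_iInter, Set.mem_ofPred_eq]
    constructor
    · exact fun hy => ⟨⟨_, y, hy, fun _ => rfl⟩, fun _ => rfl⟩
    · rintro ⟨⟨σ, x, hx, hxσ⟩, hy⟩
      exact hG x y (fun g hg => (hxσ ⟨g, hg⟩).trans (hy ⟨g, hg⟩).symm) hx
  rw [hA]
  exact iUnion fun σ => iInter fun g => sign_functionalEval_eq g.1 _

/-- Converse to `of_sign_determined`; together they reduce projection to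
`exists_finset_sign_determining`, with points of `E` acting as specializations. -/
theorem exists_sign_determining {A : Set E} (hA : IsSemialgebraicSet A) :
    ∃ G : Finset (MvPolynomial (E →ₗ[ℝ] ℝ) ℝ), ∀ x y : E,
      (∀ g ∈ G, SignType.sign (functionalEval x g) = SignType.sign (functionalEval y g)) →
        (x ∈ A ↔ y ∈ A) := by
  classical
  induction hA with
  | pos ℓ q =>
    refine ⟨{MvPolynomial.rename ℓ q}, fun x y hxy => ?_⟩
    have := hxy _ (Finset.mem_singleton_self _)
    simp only [functionalEval, MvPolynomial.eval_rename] at this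
    rw [Set.mem_ofPred_eq, Set.mem_ofPred_eq, ← sign_eq_one_iff, ← sign_eq_one_iff]
    exact this ▸ Iff.rfl
  | compl _ ih =>
    obtain ⟨G, hG⟩ := ih
    exact ⟨G, fun x y hxy => not_congr (hG x y hxy)⟩
  | union _ _ ihA ihB =>
    obtain ⟨G, hG⟩ := ihA
    obtain ⟨H, hH⟩ := ihB
    exact ⟨G ∪ H, fun x y hxy => or_congr
      (hG x y fun g hg => hxy g (Finset.mem_union_left _ hg))
      (hH x y fun g hg => hxy g (Finset.mem_union_right _ hg))⟩

/-- Polynomials on `E × ℝ` as polynomials in one variable over the polynomials on `E`. -/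
noncomputable def prodToPolynomial (E : Type*) [AddCommGroup E] [Module ℝ E] :
    MvPolynomial (E × ℝ →ₗ[ℝ] ℝ) ℝ →ₐ[ℝ] Polynomial (MvPolynomial (E →ₗ[ℝ] ℝ) ℝ) :=
  MvPolynomial.aeval fun ℓ => Polynomial.C (MvPolynomial.X (ℓ ∘ₗ LinearMap.inl ℝ E ℝ)) +
    Polynomial.C (MvPolynomial.C (ℓ (0, 1))) * Polynomial.X

theorem eval_prodToPolynomial (x : E) (t : ℝ) (q : MvPolynomial (E × ℝ →ₗ[ℝ] ℝ) ℝ) :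
    ((prodToPolynomial E q).map (functionalEval x)).eval t = functionalEval (x, t) q := by
  induction q using MvPolynomial.induction_on with
  | C a =>
    rw [prodToPolynomial, MvPolynomial.aeval_C, Polynomial.algebraMap_apply,
      MvPolynomial.algebraMap_eq]
    simp [functionalEval]
  | add p q hp hq => rw [map_add, Polynomial.map_add, Polynomial.eval_add, hp, hq, map_add]
  | mul_X p ℓ hp =>
    rw [map_mul, Polynomial.map_mul, Polynomial.eval_mul, hp, map_mul]
    congr 1
    have hℓ : ℓ (x, t) = ℓ (x, 0) + ℓ (0, 1) * t := by
      have : (x, t) = (x, (0 : ℝ)) + t • ((0 : E), (1 : ℝ)) := by simp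
      rw [this, map_add, map_smul, smul_eq_mul, mul_comm]
    simp [prodToPolynomial, functionalEval, hℓ]

/-- The Tarski–Seidenberg theorem for projections along a line. -/
theorem exists_real {A : Set (E × ℝ)} (hA : IsSemialgebraicSet A) :
    IsSemialgebraicSet {x : E | ∃ t : ℝ, (x, t) ∈ A} := by
  classical
  obtain ⟨F, hF⟩ := hA.exists_sign_determining
  obtain ⟨G, hG⟩ := exists_finset_sign_determining (F.image (prodToPolynomial E))
  refine of_sign_determined G fun x y hxy ⟨t, ht⟩ => ?_
  obtain ⟨s, hs⟩ := hG (functionalEval x) (functionalEval y) hxy t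
  refine ⟨s, (hF (x, t) (y, s) fun p hp => ?_).1 ht⟩
  simpa only [eval_prodToPolynomial] using hs _ (Finset.mem_image_of_mem _ hp)

theorem exists_fin {n : ℕ} {A : Set (E × (Fin n → ℝ))} (hA : IsSemialgebraicSet A) :
    IsSemialgebraicSet {x : E | ∃ v : Fin n → ℝ, (x, v) ∈ A} := by
  induction n generalizing E with
  | zero =>
    convert hA.preimage (LinearMap.inl ℝ E (Fin 0 → ℝ)) using 1
    ext x
    simp only [Set.mem_ofPred_eq, Set.mem_preimage, LinearMap.inl_apply]
    exact ⟨fun ⟨v, hv⟩ => Subsingleton.elim v 0 ▸ hv, fun h => ⟨0, h⟩⟩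
  | succ n ih =>
    let g : (E × ℝ) × (Fin n → ℝ) →ₗ[ℝ] E × (Fin (n + 1) → ℝ) :=
      { toFun := fun p => (p.1.1, Fin.cons p.1.2 p.2)
        map_add' := fun p q => by
          refine Prod.ext rfl (funext fun i => ?_)
          cases i using Fin.cases <;> simp
        map_smul' := fun a p => by
          refine Prod.ext rfl (funext fun i => ?_)
          cases i using Fin.cases <;> simp }
    convert (ih (hA.preimage g)).exists_real using 1
    ext x
    constructor
    · rintro ⟨v, hv⟩
      exact ⟨v 0, Fin.tail v, by simpa [g] using hv⟩
    · rintro ⟨t, v, hv⟩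
      exact ⟨_, hv⟩

/-- The Tarski–Seidenberg theorem for projections along a finite-dimensional space. -/
theorem exists_of_finiteDimensional {W : Type*} [AddCommGroup W] [Module ℝ W]
    [FiniteDimensional ℝ W] {A : Set (E × W)} (hA : IsSemialgebraicSet A) :
    IsSemialgebraicSet {x : E | ∃ w : W, (x, w) ∈ A} := by
  let e := (Module.finBasis ℝ W).equivFun
  convert (hA.preimage (LinearMap.id.prodMap e.symm.toLinearMap)).exists_fin using 1
  ext x
  constructor
  · rintro ⟨w, hw⟩
    exact ⟨e w, by simpa using hw⟩
  · rintro ⟨v, hv⟩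
    exact ⟨_, hv⟩

end IsSemialgebraicSet

end Semialgebraic

/-! ### The transform and its hypograph -/

section Transform

/-- A strict inequality below a supremum is witnessed by one term; points with `f x = ⊤` contribute
`-∞` and drop out. -/
theorem lt_sTransform_iff {V : Type*} [NormedAddCommGroup V] {γ : ℝ} {f : V → EReal}
    (hbot : ∀ x, f x ≠ ⊥) (y : V) (t : ℝ) :
    (t : EReal) < sTransform γ f y ↔
      ∃ w : V × ℝ, f w.1 = w.2 ∧ 0 < -w.2 - γ / 2 * ‖w.1 - y‖ ^ 2 - t := by
  rw [sTransform, lt_iSup_iff]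
  constructor
  · rintro ⟨x, hx⟩
    induction hfx : f x with
    | bot => exact absurd hfx (hbot x)
    | top => simp [hfx] at hx
    | coe s =>
      rw [hfx] at hx
      norm_cast at hx
      exact ⟨(x, s), hfx, by linarith⟩
  · rintro ⟨⟨x, s⟩, hfx, hx⟩
    refine ⟨x, ?_⟩
    dsimp only at hfx hx
    rw [hfx]
    norm_cast
    linarith

theorem sTransform_ne_bot {V : Type*} [NormedAddCommGroup V] (γ : ℝ) {f : V → EReal}
    (hbot : ∀ x, f x ≠ ⊥) (hf : ∃ x, f x ≠ ⊤) (y : V) : sTransform γ f y ≠ ⊥ := by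
  obtain ⟨x, hx⟩ := hf
  lift f x to ℝ using ⟨hx, hbot x⟩ with s hs
  refine ne_bot_of_gt ((lt_sTransform_iff hbot y (-s - γ / 2 * ‖x - y‖ ^ 2 - 1)).2
    ⟨(x, s), hs.symm, ?_⟩)
  dsimp only
  linarith

variable {V : Type*} [NormedAddCommGroup V] [InnerProductSpace ℝ V] [FiniteDimensional ℝ V]

theorem isSemialgebraicSet_hypograph_sTransform (γ : ℝ) {f : V → EReal} (hbot : ∀ x, f x ≠ ⊥)
    (hf : IsSemialgebraicFun f) :
    IsSemialgebraicSet {p : V × ℝ | (p.2 : EReal) < sTransform γ f p.1} := by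
  let b := stdOrthonormalBasis ℝ V
  let Y : (V × ℝ) × (V × ℝ) →ₗ[ℝ] V := LinearMap.fst ℝ V ℝ ∘ₗ LinearMap.fst ℝ _ _
  let T : (V × ℝ) × (V × ℝ) →ₗ[ℝ] ℝ := LinearMap.snd ℝ V ℝ ∘ₗ LinearMap.fst ℝ _ _
  let X : (V × ℝ) × (V × ℝ) →ₗ[ℝ] V := LinearMap.fst ℝ V ℝ ∘ₗ LinearMap.snd ℝ _ _
  let S : (V × ℝ) × (V × ℝ) →ₗ[ℝ] ℝ := LinearMap.snd ℝ V ℝ ∘ₗ LinearMap.snd ℝ _ _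
  have hpos := IsSemialgebraicSet.functionalEval_pos
    (-MvPolynomial.X S - MvPolynomial.C (γ / 2) *
      ∑ i, MvPolynomial.X (b.toBasis.coord i ∘ₗ (X - Y)) ^ 2 - MvPolynomial.X T)
  have hgraph := hf.1.preimage (LinearMap.snd ℝ (V × ℝ) (V × ℝ))
  convert (hgraph.inter hpos).exists_of_finiteDimensional using 1
  ext ⟨y, t⟩
  rw [Set.mem_ofPred_eq, lt_sTransform_iff hbot]
  refine exists_congr fun w => and_congr Iff.rfl ?_
  have hnorm : ‖w.1 - y‖ ^ 2 = ∑ i, b.repr (w.1 - y) i ^ 2 := by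
    rw [← b.repr.norm_map, EuclideanSpace.real_norm_sq_eq]
  simp [functionalEval, X, Y, S, T, hnorm]

/-- `g x = t` means that `t` is not below `g x` but every real `u < t` is; `g x = ⊥` means that no
real is below `g x`. -/
theorem isSemialgebraicFun_of_hypograph {E : Type*} [AddCommGroup E] [Module ℝ E] {g : E → EReal}
    (hg : IsSemialgebraicSet {p : E × ℝ | (p.2 : EReal) < g p.1}) : IsSemialgebraicFun g := by
  constructor
  · have hlt := IsSemialgebraicSet.functionalEval_pos (E := (E × ℝ) × ℝ)
      (MvPolynomial.X (LinearMap.snd ℝ E ℝ ∘ₗ LinearMap.fst ℝ (E × ℝ) ℝ) -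
        MvPolynomial.X (LinearMap.snd ℝ (E × ℝ) ℝ))
    have hpre := hg.preimage
      ((LinearMap.fst ℝ E ℝ ∘ₗ LinearMap.fst ℝ (E × ℝ) ℝ).prod (LinearMap.snd ℝ (E × ℝ) ℝ))
    convert hg.compl.inter (hlt.inter hpre.compl).exists_real.compl using 1
    ext ⟨x, t⟩
    have hiff : g x = t ↔ ¬ (t : EReal) < g x ∧ ¬ ∃ u : ℝ, u < t ∧ ¬ (u : EReal) < g x := by
      constructor
      · intro h
        rw [h]
        exact ⟨lt_irrefl _, fun ⟨u, h1, h2⟩ => h2 (EReal.coe_lt_coe_iff.2 h1)⟩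
      · rintro ⟨h1, h2⟩
        push Not at h2
        refine le_antisymm (not_lt.1 h1) (le_of_not_gt fun hlt => ?_)
        obtain ⟨u, hu1, hu2⟩ := EReal.lt_iff_exists_real_btwn.1 hlt
        exact lt_asymm hu1 (h2 u (EReal.coe_lt_coe_iff.1 hu2))
    rw [Set.mem_ofPred_eq, hiff]
    simp [functionalEval]
  · convert hg.exists_real.compl using 1
    ext x
    simp only [Set.mem_ofPred_eq, Set.mem_compl_iff, not_exists, not_lt]
    exact EReal.eq_bot_iff_forall_lt _ |>.trans
      ⟨fun h t => (h t).le, fun h t => (h (t - 1)).trans_lt (by norm_cast; linarith)⟩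

end Transform

theorem mainTheorem12 {V : Type*} [NormedAddCommGroup V] [InnerProductSpace ℝ V]
    [FiniteDimensional ℝ V] (γ : ℝ) (hγ : 0 < γ) (f : V → EReal) (hbot : ∀ x, f x ≠ ⊥)
    (hf : IsSemialgebraicFun f) :
    IsSemialgebraicFun (sTransform γ f) ∧
      ((∃ x, f x ≠ ⊤) → ∀ y, sTransform γ f y ≠ ⊥) :=
  ⟨isSemialgebraicFun_of_hypograph (isSemialgebraicSet_hypograph_sTransform γ hbot hf),
    sTransform_ne_bot γ hbot⟩
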